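/- Let $S=k[x_1,\dots,x_N]$ be a polynomial ring over a field $k$ with its standard grading. Let $G$ be a finite set of monomials of $S$. A monomial $m\in G$ is *dominant with respect to* $G$ if there are a variable $x$ and an integer $e>0$ such that $x^e\mid m$ and $x^e\nmid m'$ for all $m'\in G\setminus\{m\}$. The set $G$ is *dominant* if all its elements are dominant with respect to $G$, and *semidominant* if exactly one element of $G$ is not dominant with respect to $G$. A monomial ideal is *semidominant* if its minimal set of monomial generators is semidominant. Let $M\subseteq S$ be a semidominant ideal with minimal generating set $G=\{m_1,\dots,m_q,n\}$, where $n$ is the generator that is not dominant with respect to $G$. Then $S/M$ has a minimal graded free resolution with finitely generated free modules, and for every such resolution, $b_{i,j}$ denoting the number of elements of degree $j$ in a homogeneous basis of its $i$-th module, the regularity $\operatorname{reg}(S/M)=\max\{\,j-i : b_{i,j}\neq 0\,\}$ satisfies $$\operatorname{reg}(S/M)=\max\bigl\{\deg(\operatorname{lcm}\sigma)-|\sigma| \;:\; \sigma\subseteq G,\ n\in\sigma,\ \sigma \text{ is a dominant set}\bigr\},$$ where "$\sigma$ is dominant" means that every element of $\sigma$ is dominant with respect to $\sigma$ itself. (The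 maximum of the empty set is $-\infty$; this occurs, on both sides, only for $M=S$.) -/

import Mathlib

namespace SemidominantIdeals

/-! Monomials of `k[x_i : i ∈ ι]` are identified with their exponent vectors `u : ι →₀ ℕ`.
Under this identification divisibility is `≤`, the least common multiple is `⊔`,
the monomial `1` is `0`, and the total degree is `Finsupp.degree`. -/

section Dominance

variable {ι : Type*}

/-- `x` is a dominant variable of `m` with respect to the set `G` of monomials: for some positive
`e`, `x ^ e` divides `m` and divides no other element of `G`. -/
def IsDominantVariable (G : Finset (ι →₀ ℕ)) (m : ι →₀ ℕ) (x : ι) : Prop :=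
  ∃ e : ℕ, 0 < e ∧ e ≤ m x ∧ ∀ m' ∈ G, m' ≠ m → ¬ e ≤ m' x

/-- `m` is a dominant monomial with respect to `G` (used for `m ∈ G`). -/
def IsDominantMonomial (G : Finset (ι →₀ ℕ)) (m : ι →₀ ℕ) : Prop :=
  ∃ x : ι, IsDominantVariable G m x

/-- Every element of `G` is dominant with respect to `G`. -/
def IsDominantSet (G : Finset (ι →₀ ℕ)) : Prop :=
  ∀ m ∈ G, IsDominantMonomial G m

/-- Exactly one element of `G` is not dominant with respect to `G`. -/
def IsSemidominantSet (G : Finset (ι →₀ ℕ)) : Prop :=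
  ∃! n, n ∈ G ∧ ¬ IsDominantMonomial G n

/-- The least common multiple of a finite set of monomials (equal to `1` for the empty set). -/
noncomputable def lcmOf (s : Finset (ι →₀ ℕ)) : ι →₀ ℕ :=
  s.sup id

end Dominance

section MonomialIdeals

variable {ι : Type*} {k : Type*} [Field k]

/-- The ideal generated by the monomials with exponent vectors in `G`. -/
noncomputable def monomialIdeal (k : Type*) [Field k] (G : Finset (ι →₀ ℕ)) : Ideal (MvPolynomial ι k) :=
  Ideal.span ((fun u => MvPolynomial.monomial u (1 : k)) '' (G : Set (ι →₀ ℕ)))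

/-- `G` is a minimal generating set of `M` consisting of monomials: it generates `M`
and no proper subset of `G` does. -/
def IsMinimalGeneratingSet (M : Ideal (MvPolynomial ι k)) (G : Finset (ι →₀ ℕ)) : Prop :=
  monomialIdeal k G = M ∧ ∀ H : Finset (ι →₀ ℕ), H ⊂ G → monomialIdeal k H ≠ M

end MonomialIdeals

section Resolutions

variable {ι : Type*} {k : Type*} [Field k]

/-- `p` is homogeneous of degree `e ∈ ℤ` in the standard grading
(so `p = 0` when `e` is negative). -/
def IsHomogeneousOfDegree (p : MvPolynomial ι k) (e : ℤ) : Prop :=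
  ∀ u ∈ p.support, ((Finsupp.degree u : ℕ) : ℤ) = e

/-- A minimal graded free resolution
`⋯ → F₂ → F₁ → F₀ → S/I → 0` over `S = k[x_i : i ∈ ι]` with the standard grading, where
`F_i = ⨁_a S(-deg i a)` is given by its finite homogeneous basis, `a` running over
`Fin (rank i)`. -/
structure MinimalGradedFreeResolution (I : Ideal (MvPolynomial ι k)) where
  /-- the rank of `F_i` -/
  rank : ℕ → ℕ
  /-- the degrees of the basis elements of `F_i` -/
  deg : ∀ i, Fin (rank i) → ℤ
  /-- the differential `F_{i+1} → F_i` -/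
  d : ∀ i, (Fin (rank (i + 1)) → MvPolynomial ι k) →ₗ[MvPolynomial ι k]
    (Fin (rank i) → MvPolynomial ι k)
  /-- the augmentation `F₀ → S/I` -/
  aug : (Fin (rank 0) → MvPolynomial ι k) →ₗ[MvPolynomial ι k] (MvPolynomial ι k ⧸ I)
  /-- the differentials are graded of degree `0` -/
  d_graded : ∀ i b a, IsHomogeneousOfDegree (d i (Pi.single b 1) a) (deg (i + 1) b - deg i a)
  /-- the augmentation is graded of degree `0` -/
  aug_graded : ∀ a, ∃ p : MvPolynomial ι k,
    IsHomogeneousOfDegree p (deg 0 a) ∧ aug (Pi.single a 1) = Ideal.Quotient.mk I p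
  aug_surjective : Function.Surjective aug
  exact_zero : Function.Exact (d 0) aug
  exact_succ : ∀ i, Function.Exact (d (i + 1)) (d i)
  /-- minimality: the entries of the differentials lie in the ideal generated by the variables -/
  minimal : ∀ i b a, MvPolynomial.constantCoeff (d i (Pi.single b 1) a) = 0

namespace MinimalGradedFreeResolution

variable {I : Ideal (MvPolynomial ι k)}

/-- The graded Betti number `b_{i,j}`: the number of basis elements of `F_i` of degree `j`. -/
def betti (F : MinimalGradedFreeResolution I) (i : ℕ) (j : ℤ) : ℕ :=
  (Finset.univ.filter fun a : Fin (F.rank i) => F.deg i a = j).card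

/-- The Castelnuovo-Mumford regularity `max {j - i : b_{i,j} ≠ 0}` read off from `F`, as a
supremum in `ℤ ∪ {-∞, +∞}`; it is `-∞` exactly when `F = 0`. -/
noncomputable def regularity (F : MinimalGradedFreeResolution I) : WithBot (WithTop ℤ) :=
  sSup {r | ∃ (i : ℕ) (j : ℤ), F.betti i j ≠ 0 ∧ r = ((j - (i : ℤ) : ℤ) : WithBot (WithTop ℤ))}

end MinimalGradedFreeResolution

end Resolutions

end SemidominantIdeals

/-! The minimal resolution is a subcomplex of the Taylor complex. Keep the faces `τ ⊆ G` for which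
`n` does not divide `lcm (τ \ {n})`; these are closed under taking subsets.

Exactness: in multidegree `u` only faces whose lcm divides `u` matter. If `n ∣ u`, they form a cone
with apex `n`, since adding `n` to a face does not change the condition. If `n ∤ u`, the condition
is automatic and they form a full simplex, a cone over any generator dividing `u`. The contraction
along the apex (`taylorD_contraction_add`, `insert_apex_mem_faces`) then proves exactness.

Minimality (`lcmOf_erase_ne`): deleting a vertex strictly lowers the lcm, for `v ≠ n` by dominance
of `v` and for `v = n` by the face condition.

Regularity: a face containing `n` is the same as a dominant set containing `n`
(`mem_faces_iff_isDominantSet`). A face without `n` can be enlarged by `n`, which raises the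
cardinality by one and the degree of the lcm by at least one, so it never determines the maximum.
Finally, comparison maps and homotopies show that all minimal graded resolutions have the same basis
degrees (`exists_deg_eq`), so one resolution suffices. -/

namespace SemidominantIdeals

/-! ### Homogeneous components of polynomials. -/

section Components

variable {ι : Type*} {k : Type*} [Field k]

/-- The component of `p` of degree `e ∈ ℤ`. -/
noncomputable def degreeComponent (e : ℤ) (p : MvPolynomial ι k) : MvPolynomial ι k :=
  ∑ u ∈ p.support.filter (fun u => ((Finsupp.degree u : ℕ) : ℤ) = e),
    MvPolynomial.monomial u (p.coeff u)

lemma coeff_degreeComponent (e : ℤ) (p : MvPolynomial ι k) (u : ι →₀ ℕ) :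
    (degreeComponent e p).coeff u =
      if ((Finsupp.degree u : ℕ) : ℤ) = e then p.coeff u else 0 := by
  classical
  simp only [degreeComponent, MvPolynomial.coeff_sum, MvPolynomial.coeff_monomial,
    Finset.sum_ite_eq', Finset.mem_filter, MvPolynomial.mem_support_iff]
  by_cases h : p.coeff u = 0 <;> simp [h]

lemma isHomogeneousOfDegree_iff {p : MvPolynomial ι k} {e : ℤ} :
    IsHomogeneousOfDegree p e ↔ ∀ u, ((Finsupp.degree u : ℕ) : ℤ) ≠ e → p.coeff u = 0 := by
  simp only [IsHomogeneousOfDegree, MvPolynomial.mem_support_iff]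
  exact forall_congr' fun u => not_imp_comm

lemma isHomogeneousOfDegree_degreeComponent (e : ℤ) (p : MvPolynomial ι k) :
    IsHomogeneousOfDegree (degreeComponent e p) e := by
  rw [isHomogeneousOfDegree_iff]
  intro u hu
  rw [coeff_degreeComponent, if_neg hu]

lemma degreeComponent_eq_self {p : MvPolynomial ι k} {e : ℤ} (h : IsHomogeneousOfDegree p e) :
    degreeComponent e p = p := by
  ext u
  rw [coeff_degreeComponent]
  split_ifs with hu
  · rfl
  · exact (isHomogeneousOfDegree_iff.1 h u hu).symm

lemma degreeComponent_mul {q : MvPolynomial ι k} {d : ℤ} (hq : IsHomogeneousOfDegree q d)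
    (e : ℤ) (p : MvPolynomial ι k) :
    degreeComponent e (p * q) = degreeComponent (e - d) p * q := by
  classical
  ext u
  rw [coeff_degreeComponent, MvPolynomial.coeff_mul, MvPolynomial.coeff_mul]
  have key : ∀ x ∈ Finset.HasAntidiagonal.antidiagonal u,
      (degreeComponent (e - d) p).coeff x.1 * q.coeff x.2 =
        if ((Finsupp.degree u : ℕ) : ℤ) = e then p.coeff x.1 * q.coeff x.2 else 0 := by
    intro x hx
    by_cases h2 : ((Finsupp.degree x.2 : ℕ) : ℤ) = d
    · have hdeg : ((Finsupp.degree x.1 : ℕ) : ℤ) + (Finsupp.degree x.2 : ℕ) =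
          (Finsupp.degree u : ℕ) := by
        rw [← Finset.HasAntidiagonal.mem_antidiagonal.1 hx, map_add, Nat.cast_add]
      rw [coeff_degreeComponent, ite_mul, zero_mul]
      exact if_congr (by omega) rfl rfl
    · simp [isHomogeneousOfDegree_iff.1 hq x.2 h2]
  rw [Finset.sum_congr rfl key]
  split_ifs <;> simp

lemma degreeComponent_sub (e : ℤ) (p q : MvPolynomial ι k) :
    degreeComponent e (p - q) = degreeComponent e p - degreeComponent e q := by
  ext u
  simp only [coeff_degreeComponent, MvPolynomial.coeff_sub]
  split_ifs <;> simp

lemma degreeComponent_sum {α : Type*} (s : Finset α) (e : ℤ) (p : α → MvPolynomial ι k) :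
    degreeComponent e (∑ a ∈ s, p a) = ∑ a ∈ s, degreeComponent e (p a) := by
  ext u
  simp only [coeff_degreeComponent, MvPolynomial.coeff_sum]
  split_ifs <;> simp

lemma isHomogeneousOfDegree_constantCoeff {p : MvPolynomial ι k} {e : ℤ}
    (h : IsHomogeneousOfDegree p e) (h0 : MvPolynomial.constantCoeff p ≠ 0) : e = 0 := by
  have := h 0 (by rwa [MvPolynomial.mem_support_iff, ← MvPolynomial.constantCoeff_eq])
  simpa using this.symm

lemma degreeComponent_mem_monomialIdeal {G : Finset (ι →₀ ℕ)} {p : MvPolynomial ι k}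
    (hp : p ∈ monomialIdeal k G) (e : ℤ) : degreeComponent e p ∈ monomialIdeal k G := by
  rw [monomialIdeal, MvPolynomial.mem_ideal_span_monomial_image] at hp ⊢
  intro u hu
  refine hp u ?_
  rw [MvPolynomial.mem_support_iff, coeff_degreeComponent] at hu
  rw [MvPolynomial.mem_support_iff]
  exact fun h => hu (by simp [h])

end Components

/-! ### Lifting maps out of finite free modules. -/

section Lifting

variable {R : Type*} [CommRing R]

lemma apply_eq_sum_single {r : ℕ} {N : Type*} [AddCommGroup N] [Module R N]
    (A : (Fin r → R) →ₗ[R] N) (y : Fin r → R) : A y = ∑ b, y b • A (Pi.single b 1) := by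
  conv_lhs => rw [pi_eq_sum_univ' y]
  simp [map_sum]

/-- A linear map out of a finite free module lifts along `A` if it does so on the basis. -/
lemma exists_lift {r : ℕ} {N P : Type*} [AddCommGroup N] [Module R N] [AddCommGroup P] [Module R P]
    (A : N →ₗ[R] P) (B : (Fin r → R) →ₗ[R] P) (Q : Fin r → N → Prop)
    (h : ∀ b, ∃ y, A y = B (Pi.single b 1) ∧ Q b y) :
    ∃ L : (Fin r → R) →ₗ[R] N, (∀ x, A (L x) = B x) ∧ ∀ b, Q b (L (Pi.single b 1)) := by
  choose y hy hQ using h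
  have hL : ∀ b, (Pi.basisFun R (Fin r)).constr R y (Pi.single b 1) = y b := fun b => by
    rw [← Pi.basisFun_apply R, Module.Basis.constr_basis]
  refine ⟨(Pi.basisFun R (Fin r)).constr R y, fun x => ?_, fun b => by rw [hL]; exact hQ b⟩
  rw [apply_eq_sum_single _ x, apply_eq_sum_single B x, map_sum]
  simp [hL, hy]

end Lifting

/-! ### Graded maps between free modules. -/

section GradedMaps

variable {ι : Type*} {k : Type*} [Field k]

/-- The component of degree `e` of an element of the graded free module with basis degrees `δ`. -/
noncomputable def vectorComponent {r : ℕ} (δ : Fin r → ℤ) (e : ℤ)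
    (y : Fin r → MvPolynomial ι k) : Fin r → MvPolynomial ι k :=
  fun a => degreeComponent (e - δ a) (y a)

/-- A linear map of graded free modules is graded of degree `0`. -/
def IsGradedMap {r s : ℕ} (δ : Fin r → ℤ) (δ' : Fin s → ℤ)
    (A : (Fin r → MvPolynomial ι k) →ₗ[MvPolynomial ι k] (Fin s → MvPolynomial ι k)) : Prop :=
  ∀ b a, IsHomogeneousOfDegree (A (Pi.single b 1) a) (δ b - δ' a)

lemma IsGradedMap.map_vectorComponent {r s : ℕ} {δ : Fin r → ℤ} {δ' : Fin s → ℤ}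
    {A : (Fin r → MvPolynomial ι k) →ₗ[MvPolynomial ι k] (Fin s → MvPolynomial ι k)}
    (hA : IsGradedMap δ δ' A) (e : ℤ) (y : Fin r → MvPolynomial ι k) :
    A (vectorComponent δ e y) = vectorComponent δ' e (A y) := by
  funext a
  rw [apply_eq_sum_single A (vectorComponent δ e y), vectorComponent, apply_eq_sum_single A y]
  simp only [Finset.sum_apply, Pi.smul_apply, smul_eq_mul, degreeComponent_sum]
  refine Finset.sum_congr rfl fun b _ => ?_
  rw [degreeComponent_mul (hA b a), vectorComponent]
  congr 2
  ring

lemma vectorComponent_single {r : ℕ} (δ : Fin r → ℤ) (b : Fin r) :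
    vectorComponent δ (δ b) (Pi.single b (1 : MvPolynomial ι k)) = Pi.single b 1 := by
  classical
  funext a
  apply degreeComponent_eq_self
  rw [isHomogeneousOfDegree_iff]
  intro u hu
  by_cases h : a = b
  · subst h
    rw [Pi.single_eq_same, MvPolynomial.coeff_one, if_neg]
    rintro rfl
    simp at hu
  · rw [Pi.single_eq_of_ne h, MvPolynomial.coeff_zero]

/-- Serves both halves of minimality: composites in which either factor has no constant terms have
none themselves. -/
lemma constantCoeff_apply_eq_zero {r s : ℕ}
    (A : (Fin r → MvPolynomial ι k) →ₗ[MvPolynomial ι k] (Fin s → MvPolynomial ι k))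
    (y : Fin r → MvPolynomial ι k) (a : Fin s)
    (h : ∀ b, MvPolynomial.constantCoeff (y b) = 0 ∨
      MvPolynomial.constantCoeff (A (Pi.single b 1) a) = 0) :
    MvPolynomial.constantCoeff (A y a) = 0 := by
  rw [apply_eq_sum_single A y]
  simp only [Finset.sum_apply, Pi.smul_apply, smul_eq_mul, map_sum, map_mul]
  exact Finset.sum_eq_zero fun b _ => mul_eq_zero.2 (h b)

end GradedMaps

/-! ### Independence of the regularity from the resolution. -/

namespace MinimalGradedFreeResolution

variable {ι : Type*} {k : Type*} [Field k] {I : Ideal (MvPolynomial ι k)}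

/-- Homogeneity of `I` lets a preimage of a homogeneous class be replaced by its component of the
right degree; this makes the comparison maps graded. -/
lemma aug_vectorComponent (hI : ∀ p ∈ I, ∀ e, degreeComponent e p ∈ I)
    (F : MinimalGradedFreeResolution I) {e : ℤ} {p : MvPolynomial ι k}
    (hp : IsHomogeneousOfDegree p e) {y : Fin (F.rank 0) → MvPolynomial ι k}
    (hy : F.aug y = Ideal.Quotient.mk I p) :
    F.aug (vectorComponent (F.deg 0) e y) = Ideal.Quotient.mk I p := by
  choose q hq hq' using F.aug_graded
  have key : ∀ z, F.aug z = Ideal.Quotient.mk I (∑ b, z b * q b) := fun z => by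
    rw [apply_eq_sum_single F.aug z, map_sum]
    exact Finset.sum_congr rfl fun b _ => by
      rw [hq', map_mul]; rfl
  rw [key, Ideal.Quotient.eq] at hy ⊢
  have := hI _ hy e
  rw [degreeComponent_sub, degreeComponent_sum, degreeComponent_eq_self hp] at this
  convert this using 3 with b
  exact (degreeComponent_mul (hq b) e (y b)).symm

/-- Graded comparison maps between two resolutions, in homological degrees at most `N`. -/
lemma exists_comparison (hI : ∀ p ∈ I, ∀ e, degreeComponent e p ∈ I)
    (F F' : MinimalGradedFreeResolution I) (N : ℕ) :
    ∃ f : ∀ i, (Fin (F.rank i) → MvPolynomial ι k) →ₗ[MvPolynomial ι k]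
      (Fin (F'.rank i) → MvPolynomial ι k),
      (∀ i, i ≤ N → IsGradedMap (F.deg i) (F'.deg i) (f i)) ∧
      (∀ x, F'.aug (f 0 x) = F.aug x) ∧
      ∀ i, i < N → ∀ x, F'.d i (f (i + 1) x) = f i (F.d i x) := by
  induction N with
  | zero =>
    obtain ⟨L, hL, hQ⟩ := exists_lift F'.aug F.aug
      (fun b y => ∀ a, IsHomogeneousOfDegree (y a) (F.deg 0 b - F'.deg 0 a)) (fun b => by
        obtain ⟨p, hp, hp'⟩ := F.aug_graded b
        obtain ⟨y, hy⟩ := F'.aug_surjective (F.aug (Pi.single b 1))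
        rw [hp'] at hy ⊢
        exact ⟨_, F'.aug_vectorComponent hI hp hy,
          fun a => isHomogeneousOfDegree_degreeComponent _ _⟩)
    -- The zero maps in higher degrees are placeholders: nothing is claimed above `N`.
    refine ⟨Function.update (fun _ => 0) 0 L, ?_, ?_, ?_⟩
    · intro i hi
      obtain rfl : i = 0 := by omega
      rw [Function.update_self]
      exact hQ
    · simpa using hL
    · intro i hi
      omega
  | succ N ih =>
    obtain ⟨f, hf, hf0, hfd⟩ := ih
    obtain ⟨L, hL, hQ⟩ := exists_lift (F'.d N) ((f N).comp (F.d N))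
      (fun b y => ∀ a, IsHomogeneousOfDegree (y a) (F.deg (N + 1) b - F'.deg (N + 1) a))
      (fun b => by
        have hz : ∃ y, F'.d N y = f N (F.d N (Pi.single b 1)) := by
          cases N with
          | zero => exact (F'.exact_zero _).1 (by rw [hf0]; exact F.exact_zero.apply_apply_eq_zero _)
          | succ N =>
            exact (F'.exact_succ N _).1 (by
              rw [hfd N (by omega), (F.exact_succ N).apply_apply_eq_zero, map_zero])
        obtain ⟨y, hy⟩ := hz
        refine ⟨vectorComponent (F'.deg (N + 1)) (F.deg (N + 1) b) y, ?_,
          fun a => isHomogeneousOfDegree_degreeComponent _ _⟩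
        rw [IsGradedMap.map_vectorComponent (F'.d_graded N), hy,
          ← (hf N le_rfl).map_vectorComponent,
          ← IsGradedMap.map_vectorComponent (F.d_graded N), vectorComponent_single]
        rfl)
    refine ⟨Function.update f (N + 1) L, ?_, ?_, ?_⟩
    · intro i hi
      rcases eq_or_ne i (N + 1) with rfl | h
      · rw [Function.update_self]
        exact hQ
      · rw [Function.update_of_ne h]
        exact hf i (by omega)
    · rwa [Function.update_of_ne (by omega)]
    · intro i hi x
      rw [Function.update_of_ne (by omega : i ≠ N + 1)]
      rcases eq_or_ne i N with rfl | h
      · rw [Function.update_self]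
        exact hL x
      · rw [Function.update_of_ne (by omega)]
        exact hfd i (by omega) x

/-- A chain endomorphism that induces zero on `S/I` is null-homotopic. -/
lemma exists_homotopy (F : MinimalGradedFreeResolution I) (N : ℕ)
    (φ : ∀ i, (Fin (F.rank i) → MvPolynomial ι k) →ₗ[MvPolynomial ι k]
      (Fin (F.rank i) → MvPolynomial ι k))
    (h0 : ∀ x, F.aug (φ 0 x) = 0)
    (hφ : ∀ i, i < N → ∀ x, F.d i (φ (i + 1) x) = φ i (F.d i x)) :
    ∃ h : ∀ i, (Fin (F.rank i) → MvPolynomial ι k) →ₗ[MvPolynomial ι k]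
      (Fin (F.rank (i + 1)) → MvPolynomial ι k),
      (∀ x, F.d 0 (h 0 x) = φ 0 x) ∧
      ∀ i, i < N → ∀ x, F.d (i + 1) (h (i + 1) x) = φ (i + 1) x - h i (F.d i x) := by
  induction N with
  | zero =>
    obtain ⟨L, hL, -⟩ := exists_lift (F.d 0) (φ 0) (fun _ _ => True)
      (fun b => by simpa using (F.exact_zero _).1 (h0 (Pi.single b 1)))
    exact ⟨Function.update (fun _ => 0) 0 L, by simpa using hL, by simp⟩
  | succ N ih =>
    obtain ⟨h, hh0, hh⟩ := ih fun i hi => hφ i (by omega)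
    -- This makes `φ (N + 1) - h N ∘ d N` land in the cycles, so that it lifts.
    have hN : ∀ x, F.d N (h N (F.d N x)) = φ N (F.d N x) := by
      intro x
      cases N with
      | zero => exact hh0 _
      | succ N =>
        rw [hh N (by omega), (F.exact_succ N).apply_apply_eq_zero, map_zero, sub_zero]
    obtain ⟨L, hL, -⟩ := exists_lift (F.d (N + 1)) (φ (N + 1) - (h N).comp (F.d N))
      (fun _ _ => True) (fun b => by
        simpa using (F.exact_succ N _).1 (by
          rw [map_sub, hφ N (by omega), hN, sub_self] :
          F.d N (φ (N + 1) (Pi.single b 1) - h N (F.d N (Pi.single b 1))) = 0))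
    refine ⟨Function.update h (N + 1) L, ?_, ?_⟩
    · rwa [Function.update_of_ne (by omega)]
    · intro i hi x
      rw [Function.update_of_ne (by omega : i ≠ N + 1)]
      rcases eq_or_ne i N with rfl | hne
      · rw [Function.update_self]
        exact hL x
      · rw [Function.update_of_ne (by omega)]
        exact hh i (by omega) x

/-- The degrees of the basis elements in a given homological degree do not depend on the
minimal graded free resolution. -/
lemma exists_deg_eq (hI : ∀ p ∈ I, ∀ e, degreeComponent e p ∈ I)
    (F F' : MinimalGradedFreeResolution I) (i : ℕ) (b : Fin (F.rank i)) :
    ∃ a : Fin (F'.rank i), F'.deg i a = F.deg i b := by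
  obtain ⟨f, hf, hf0, hfd⟩ := exists_comparison hI F F' i
  obtain ⟨g, -, hg0, hgd⟩ := exists_comparison hI F' F i
  let φ : ∀ i, (Fin (F.rank i) → MvPolynomial ι k) →ₗ[MvPolynomial ι k]
      (Fin (F.rank i) → MvPolynomial ι k) := fun i => (g i).comp (f i) - LinearMap.id
  obtain ⟨h, hh0, hh⟩ := F.exists_homotopy i φ
    (fun x => by simp [φ, hg0, hf0])
    (fun i hi x => by simp [φ, hgd i hi, hfd i hi])
  have hd : ∀ (i : ℕ) (y) (a), MvPolynomial.constantCoeff (F.d i y a) = 0 := fun i y a =>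
    constantCoeff_apply_eq_zero _ _ _ fun b => Or.inr (F.minimal i b a)
  -- `g f - 1` has the form `d h + h d`, and minimality kills all constant terms of that.
  have key : MvPolynomial.constantCoeff (g i (f i (Pi.single b 1)) b) = 1 := by
    have : MvPolynomial.constantCoeff (φ i (Pi.single b 1) b) = 0 := by
      cases i with
      | zero => rw [← hh0]; exact hd _ _ _
      | succ i =>
        rw [← sub_add_cancel (φ (i + 1) (Pi.single b 1)) (h i (F.d i (Pi.single b 1))),
          ← hh i (by omega), Pi.add_apply, map_add, hd, zero_add]
        exact constantCoeff_apply_eq_zero _ _ _ fun c => Or.inl (hd _ _ _)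
    simpa [φ, sub_eq_zero] using this
  by_contra! hne
  -- A constant term `1` in `g f` forces a nonzero constant term in an entry of `f`; that entry is
  -- homogeneous, so the two basis degrees agree.
  refine one_ne_zero (key.symm.trans (constantCoeff_apply_eq_zero _ _ _ fun a => Or.inl ?_))
  by_contra h0
  have := isHomogeneousOfDegree_constantCoeff (hf i le_rfl b a) h0
  exact hne a (by omega)

lemma betti_ne_zero_iff_exists (F : MinimalGradedFreeResolution I) (i : ℕ) (j : ℤ) :
    F.betti i j ≠ 0 ↔ ∃ a, F.deg i a = j := by
  simp [betti, Finset.card_eq_zero, Finset.filter_eq_empty_iff]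

lemma regularity_eq (hI : ∀ p ∈ I, ∀ e, degreeComponent e p ∈ I)
    (F F' : MinimalGradedFreeResolution I) : F.regularity = F'.regularity := by
  have key : ∀ (F F' : MinimalGradedFreeResolution I) (i : ℕ) (j : ℤ),
      F.betti i j ≠ 0 → F'.betti i j ≠ 0 := by
    intro F F' i j
    rw [betti_ne_zero_iff_exists, betti_ne_zero_iff_exists]
    rintro ⟨b, rfl⟩
    exact exists_deg_eq hI F F' i b
  have : ∀ i j, F.betti i j ≠ 0 ↔ F'.betti i j ≠ 0 := fun i j => ⟨key F F' i j, key F' F i j⟩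
  simp only [regularity, this]

end MinimalGradedFreeResolution

/-! ### Least common multiples. -/

section Lcm

variable {ι : Type*}

lemma lcmOf_mono {s t : Finset (ι →₀ ℕ)} (h : s ⊆ t) : lcmOf s ≤ lcmOf t :=
  Finset.sup_mono h

lemma le_lcmOf {s : Finset (ι →₀ ℕ)} {v : ι →₀ ℕ} (h : v ∈ s) : v ≤ lcmOf s :=
  Finset.le_sup (f := id) h

lemma lcmOf_insert_le [DecidableEq (ι →₀ ℕ)] {s : Finset (ι →₀ ℕ)} {u v : ι →₀ ℕ}
    (hs : lcmOf s ≤ u) (hv : v ≤ u) : lcmOf (insert v s) ≤ u := by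
  rw [lcmOf, Finset.sup_insert]
  exact sup_le hv hs

lemma exists_le_of_le_lcmOf {s : Finset (ι →₀ ℕ)} {x : ι} {e : ℕ} (he : 0 < e)
    (h : e ≤ lcmOf s x) : ∃ m ∈ s, e ≤ m x := by
  classical
  induction s using Finset.induction_on with
  | empty =>
    rw [lcmOf, Finset.sup_empty, bot_eq_zero, Finsupp.coe_zero, Pi.zero_apply] at h
    omega
  | insert a s _ ih =>
    rw [lcmOf, Finset.sup_insert, Finsupp.sup_apply, le_sup_iff] at h
    rcases h with h | h
    · exact ⟨a, by simp, h⟩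
    · obtain ⟨m, hm, hm'⟩ := ih h
      exact ⟨m, by simp [hm], hm'⟩

end Lcm

/-! ### The Taylor differential and its contractions. -/

section Taylor

variable {ι : Type*} (k : Type*) [Field k]

open Classical in
/-- The sign of the facet opposite to `v` in the boundary of the simplex `τ`. -/
noncomputable def facetSign (v : ι →₀ ℕ) (τ : Finset (ι →₀ ℕ)) : k :=
  (-1) ^ (τ.filter fun w => WellOrderingRel w v).card

lemma facetSign_mul_self (v : ι →₀ ℕ) (τ : Finset (ι →₀ ℕ)) :
    facetSign k v τ * facetSign k v τ = 1 := by
  rw [facetSign, ← mul_pow]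
  simp

open Classical in
lemma facetSign_erase_of_rel {v w : ι →₀ ℕ} {τ : Finset (ι →₀ ℕ)} (hw : w ∈ τ)
    (h : WellOrderingRel w v) : facetSign k v (τ.erase w) = - facetSign k v τ := by
  have hm : w ∈ τ.filter fun w => WellOrderingRel w v := Finset.mem_filter.2 ⟨hw, h⟩
  rw [facetSign, facetSign, Finset.filter_erase, ← Finset.card_erase_add_one hm, pow_succ]
  ring

open Classical in
lemma facetSign_erase_of_not_rel {v w : ι →₀ ℕ} {τ : Finset (ι →₀ ℕ)}
    (h : ¬ WellOrderingRel w v) : facetSign k v (τ.erase w) = facetSign k v τ := by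
  rw [facetSign, facetSign, Finset.filter_erase, Finset.erase_eq_of_notMem (by simp [h])]

-- Deleting the earlier of two vertices shifts the position of the later one by one, while deleting
-- the later leaves the earlier in place.
open Classical in
lemma facetSign_anticomm {v w : ι →₀ ℕ} {τ : Finset (ι →₀ ℕ)} (hv : v ∈ τ) (hw : w ∈ τ)
    (h : v ≠ w) : facetSign k v τ * facetSign k w (τ.erase v) =
      - (facetSign k w τ * facetSign k v (τ.erase w)) := by
  rcases trichotomous_of WellOrderingRel v w with hvw | hvw | hvw
  · rw [facetSign_erase_of_rel k hv hvw, facetSign_erase_of_not_rel k (asymm hvw)]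
    ring
  · exact absurd hvw h
  · rw [facetSign_erase_of_rel k hw hvw, facetSign_erase_of_not_rel k (asymm hvw)]
    ring

/-- The free module on all finite sets of monomials, carrying the Taylor differential. -/
abbrev TaylorModule (ι k : Type*) [Field k] := Finset (ι →₀ ℕ) →₀ MvPolynomial ι k

open Classical in
/-- The Taylor differential. -/
noncomputable def taylorD : TaylorModule ι k →ₗ[MvPolynomial ι k] TaylorModule ι k :=
  Finsupp.linearCombination _ fun τ => ∑ v ∈ τ, Finsupp.single (τ.erase v)
    (MvPolynomial.monomial (lcmOf τ - lcmOf (τ.erase v)) (facetSign k v τ))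

/-- The element of multidegree `u` supported on the face `τ`. -/
noncomputable def faceElem (τ : Finset (ι →₀ ℕ)) (u : ι →₀ ℕ) : TaylorModule ι k :=
  Finsupp.single τ (MvPolynomial.monomial (u - lcmOf τ) 1)

open Classical in
lemma taylorD_faceElem {τ : Finset (ι →₀ ℕ)} {u : ι →₀ ℕ} (h : lcmOf τ ≤ u) :
    taylorD k (faceElem k τ u) = ∑ v ∈ τ, facetSign k v τ • faceElem k (τ.erase v) u := by
  rw [taylorD, faceElem, Finsupp.linearCombination_single, Finset.smul_sum]
  refine Finset.sum_congr rfl fun v _ => ?_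
  rw [Finsupp.smul_single, smul_eq_mul, MvPolynomial.monomial_mul, faceElem, Finsupp.smul_single,
    MvPolynomial.smul_monomial, smul_eq_mul, one_mul, mul_one,
    tsub_add_tsub_cancel h (lcmOf_mono (Finset.erase_subset v τ))]

/-- The monomial `w` on the face `τ` has multidegree `w + lcmOf τ`, so the face elements span over
`k`. Only `k`-linearity is asked because a contraction whose apex varies with the multidegree need
not be linear over the polynomial ring. -/
lemma taylorModule_hom_ext {N : Type*} [AddCommMonoid N] [Module k N]
    {f g : TaylorModule ι k →ₗ[k] N}
    (h : ∀ τ u, lcmOf τ ≤ u → f (faceElem k τ u) = g (faceElem k τ u)) : f = g := by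
  refine Finsupp.lhom_ext' fun τ => (MvPolynomial.basisMonomials ι k).ext fun w => ?_
  simpa [faceElem] using h τ (w + lcmOf τ) le_add_self

open Classical in
lemma taylorD_taylorD (x : TaylorModule ι k) : taylorD k (taylorD k x) = 0 := by
  suffices h : ((taylorD k).comp (taylorD k)).restrictScalars k =
      (0 : TaylorModule ι k →ₗ[k] TaylorModule ι k) from LinearMap.congr_fun h x
  refine taylorModule_hom_ext k fun τ u hu => ?_
  simp only [LinearMap.coe_restrictScalars, LinearMap.comp_apply, LinearMap.zero_apply]
  rw [taylorD_faceElem k hu, map_sum]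
  have : ∀ v ∈ τ, taylorD k (facetSign k v τ • faceElem k (τ.erase v) u) =
      ∑ w ∈ τ.erase v, (facetSign k v τ * facetSign k w (τ.erase v)) •
        faceElem k ((τ.erase v).erase w) u := by
    intro v _
    rw [LinearMap.map_smul_of_tower,
      taylorD_faceElem k ((lcmOf_mono (Finset.erase_subset v τ)).trans hu), Finset.smul_sum]
    simp only [smul_smul]
  rw [Finset.sum_congr rfl this, Finset.sum_sigma']
  -- Deleting two vertices in either order gives the same face with opposite signs.
  refine Finset.sum_involution (fun p _ => ⟨p.2, p.1⟩) ?_ ?_ ?_ ?_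
  · rintro ⟨v, w⟩ hp
    simp only [Finset.mem_sigma, Finset.mem_erase] at hp
    simp only
    rw [facetSign_anticomm k hp.1 hp.2.2 hp.2.1.symm, Finset.erase_right_comm, neg_smul,
      neg_add_cancel]
  · rintro ⟨v, w⟩ hp _ heq
    simp only [Finset.mem_sigma, Finset.mem_erase] at hp
    simp only [Sigma.mk.injEq] at heq
    exact hp.2.1 heq.1
  · rintro ⟨v, w⟩ hp
    simp only [Finset.mem_sigma, Finset.mem_erase] at hp ⊢
    exact ⟨hp.2.2, hp.2.1.symm, hp.1⟩
  · rintro ⟨v, w⟩ _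
    rfl

open Classical in
/-- The value on the face `τ` in multidegree `u` of the contraction with apex `v`. -/
noncomputable def coneElem (v : ι →₀ ℕ) (τ : Finset (ι →₀ ℕ)) (u : ι →₀ ℕ) : TaylorModule ι k :=
  if v ∈ τ then 0 else facetSign k v (insert v τ) • faceElem k (insert v τ) u

lemma basisMonomials_constr_monomial {N : Type*} [AddCommMonoid N] [Module k N]
    (f : (ι →₀ ℕ) → N) (w : ι →₀ ℕ) :
    (MvPolynomial.basisMonomials ι k).constr k f (MvPolynomial.monomial w 1) = f w := by
  simpa using (MvPolynomial.basisMonomials ι k).constr_basis k f w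

/-- The contraction with apex `c u` in multidegree `u`. -/
noncomputable def contraction (c : (ι →₀ ℕ) → ι →₀ ℕ) : TaylorModule ι k →ₗ[k] TaylorModule ι k :=
  Finsupp.lsum k fun τ => (MvPolynomial.basisMonomials ι k).constr k fun w =>
    coneElem k (c (w + lcmOf τ)) τ (w + lcmOf τ)

lemma contraction_faceElem (c : (ι →₀ ℕ) → ι →₀ ℕ) {τ : Finset (ι →₀ ℕ)} {u : ι →₀ ℕ}
    (h : lcmOf τ ≤ u) : contraction k c (faceElem k τ u) = coneElem k (c u) τ u := by
  rw [contraction, faceElem, Finsupp.lsum_single, basisMonomials_constr_monomial, tsub_add_cancel_of_le h]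

-- In each multidegree this is the usual homotopy of a simplex with a cone point; `c u ≤ u` keeps
-- the enlarged face in multidegree `u`.
open Classical in
lemma taylorD_contraction_add (c : (ι →₀ ℕ) → ι →₀ ℕ) (hc : ∀ u, c u ≤ u)
    (x : TaylorModule ι k) :
    taylorD k (contraction k c x) + contraction k c (taylorD k x) = x := by
  suffices h : ((taylorD k).restrictScalars k).comp (contraction k c) +
      (contraction k c).comp ((taylorD k).restrictScalars k) = LinearMap.id from
    LinearMap.congr_fun h x
  refine taylorModule_hom_ext k fun τ u hu => ?_
  simp only [LinearMap.add_apply, LinearMap.comp_apply, LinearMap.coe_restrictScalars,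
    LinearMap.id_apply]
  have he : ∀ v, lcmOf (τ.erase v) ≤ u := fun v => (lcmOf_mono (Finset.erase_subset v τ)).trans hu
  rw [contraction_faceElem k c hu, taylorD_faceElem k hu, map_sum]
  simp only [map_smul, contraction_faceElem k c (he _)]
  have hv := hc u
  generalize c u = v at hv
  by_cases h : v ∈ τ
  · rw [Finset.sum_eq_single_of_mem v h]
    · simp [coneElem, h, Finset.insert_erase h, smul_smul, facetSign_mul_self]
    · intro w _ hwv
      simp [coneElem, h, hwv.symm]
  · rw [coneElem, if_neg h, LinearMap.map_smul_of_tower,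
      taylorD_faceElem k (lcmOf_insert_le hu hv), Finset.sum_insert h, Finset.erase_insert h,
      smul_add, smul_smul, facetSign_mul_self, one_smul, add_assoc, Finset.smul_sum,
      ← Finset.sum_add_distrib, Finset.sum_eq_zero, add_zero]
    intro w hw
    have hwv : w ≠ v := fun h' => h (h' ▸ hw)
    have hev : (insert v τ).erase w = insert v (τ.erase w) :=
      Finset.erase_insert_of_ne hwv.symm
    rw [coneElem, if_neg (by simp [h]), smul_smul, smul_smul, ← hev, ← add_smul]
    have hanti := facetSign_anticomm k (Finset.mem_insert_self v τ)
      (Finset.mem_insert_of_mem hw : w ∈ insert v τ) hwv.symm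
    rw [Finset.erase_insert h] at hanti
    have h1 := facetSign_mul_self k w (insert v τ)
    have h2 := facetSign_mul_self k w τ
    convert zero_smul k _
    -- Multiply `hanti` by two signs and remove the squares, which are `1`.
    linear_combination (-facetSign k w τ * facetSign k v ((insert v τ).erase w)) * h1 -
      facetSign k v (insert v τ) * facetSign k w (insert v τ) * h2 +
      facetSign k w τ * facetSign k w (insert v τ) * hanti

open Classical in
lemma taylorD_single_apply (τ ρ : Finset (ι →₀ ℕ)) :
    taylorD k (Finsupp.single τ 1) ρ = 0 ∨ ∃ v ∈ τ, ρ = τ.erase v ∧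
      taylorD k (Finsupp.single τ 1) ρ =
        MvPolynomial.monomial (lcmOf τ - lcmOf ρ) (facetSign k v τ) := by
  rw [taylorD, Finsupp.linearCombination_single, one_smul, Finsupp.finsetSum_apply]
  by_cases h : ∃ v ∈ τ, ρ = τ.erase v
  · obtain ⟨v, hv, rfl⟩ := h
    refine Or.inr ⟨v, hv, rfl, ?_⟩
    rw [Finset.sum_eq_single_of_mem v hv, Finsupp.single_eq_same]
    intro w hw hwv
    refine Finsupp.single_eq_of_ne fun h => hwv ?_
    exact (Finset.erase_injOn τ hv hw h).symm
  · push Not at h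
    exact Or.inl (Finset.sum_eq_zero fun v hv => Finsupp.single_eq_of_ne (h v hv))

lemma contraction_mem_supported (c : (ι →₀ ℕ) → ι →₀ ℕ) (A : Set (Finset (ι →₀ ℕ)))
    (x : TaylorModule ι k)
    (h : ∀ τ, ∀ w ∈ (x τ).support, coneElem k (c (w + lcmOf τ)) τ (w + lcmOf τ) ∈
      Finsupp.supported (MvPolynomial ι k) (MvPolynomial ι k) A) :
    contraction k c x ∈ Finsupp.supported (MvPolynomial ι k) (MvPolynomial ι k) A := by
  rw [contraction, Finsupp.lsum_apply]
  refine Submodule.finsuppSum_mem _ _ _ _ fun τ _ => ?_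
  rw [(x τ).as_sum, map_sum]
  refine Submodule.sum_mem _ fun w hw => ?_
  rw [← mul_one ((x τ).coeff w), ← smul_eq_mul, ← MvPolynomial.smul_monomial, map_smul,
    basisMonomials_constr_monomial]
  exact Submodule.smul_of_tower_mem _ _ (h τ w hw)

end Taylor

/-! ### Coordinates on free modules with a finite basis. -/

section Coordinates

variable {R : Type*} [CommRing R] {α : Type*} (A : Finset α)

/-- The inclusion of the free module on the elements of `A`. -/
noncomputable def ofCoords : (Fin A.card → R) →ₗ[R] (α →₀ R) :=
  Fintype.linearCombination R fun a => Finsupp.single (A.equivFin.symm a : α) 1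

/-- The coordinates at the elements of `A`. -/
noncomputable def toCoords : (α →₀ R) →ₗ[R] (Fin A.card → R) :=
  LinearMap.pi fun a => Finsupp.lapply (A.equivFin.symm a : α)

lemma toCoords_apply (x : α →₀ R) (a : Fin A.card) :
    toCoords A x a = x (A.equivFin.symm a : α) := rfl

lemma ofCoords_single (a : Fin A.card) :
    ofCoords A (Pi.single a (1 : R)) = Finsupp.single (A.equivFin.symm a : α) 1 := by
  rw [ofCoords, Fintype.linearCombination_apply_single, one_smul]

lemma ofCoords_mem_supported (x : Fin A.card → R) :
    ofCoords A x ∈ Finsupp.supported R R (A : Set α) := by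
  rw [ofCoords, Fintype.linearCombination_apply]
  exact Submodule.sum_mem _ fun a _ => Submodule.smul_mem _ _
    (Finsupp.single_mem_supported R _ (A.equivFin.symm a).2)

lemma toCoords_ofCoords (x : Fin A.card → R) : toCoords A (ofCoords A x) = x := by
  classical
  suffices h : (toCoords A).comp (ofCoords A) = (LinearMap.id : (Fin A.card → R) →ₗ[R] _) from
    LinearMap.congr_fun h x
  refine (Pi.basisFun R _).ext fun a => funext fun b => ?_
  rw [Pi.basisFun_apply, LinearMap.comp_apply, ofCoords_single, toCoords_apply, LinearMap.id_apply]
  by_cases h : b = a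
  · subst h; simp
  · rw [Pi.single_eq_of_ne h, Finsupp.single_eq_of_ne]
    exact fun h' => h (A.equivFin.symm.injective (Subtype.ext h'))

lemma ofCoords_toCoords {x : α →₀ R} (hx : x ∈ Finsupp.supported R R (A : Set α)) :
    ofCoords A (toCoords A x) = x := by
  classical
  ext t
  by_cases ht : t ∈ A
  · have := congrFun (toCoords_ofCoords A (toCoords A x)) (A.equivFin ⟨t, ht⟩)
    simpa [toCoords_apply] using this
  · rw [(Finsupp.mem_supported' R _).1 hx t ht,
      (Finsupp.mem_supported' R _).1 (ofCoords_mem_supported A _) t ht]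

end Coordinates

/-! ### Combinatorics of the faces. -/

section Faces

variable {ι : Type*}

open Classical in
/-- The sets `τ ⊆ G` with `i` elements such that `n` does not divide the least common multiple of
`τ \ {n}`. -/
noncomputable def faces (G : Finset (ι →₀ ℕ)) (n : ι →₀ ℕ) (i : ℕ) : Finset (Finset (ι →₀ ℕ)) :=
  (G.powersetCard i).filter fun τ => ¬ n ≤ lcmOf (τ.erase n)

variable {G : Finset (ι →₀ ℕ)} {n : ι →₀ ℕ} {i : ℕ} {τ : Finset (ι →₀ ℕ)}

open Classical in
lemma mem_faces : τ ∈ faces G n i ↔ τ ⊆ G ∧ τ.card = i ∧ ¬ n ≤ lcmOf (τ.erase n) := by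
  rw [faces, Finset.mem_filter, Finset.mem_powersetCard, and_assoc]

open Classical in
lemma erase_mem_faces (h : τ ∈ faces G n (i + 1)) {v : ι →₀ ℕ} (hv : v ∈ τ) :
    τ.erase v ∈ faces G n i := by
  rw [mem_faces] at h ⊢
  refine ⟨(Finset.erase_subset v τ).trans h.1, ?_, fun hn => h.2.2 (hn.trans (lcmOf_mono ?_))⟩
  · rw [Finset.card_erase_of_mem hv, h.2.1, Nat.add_sub_cancel]
  · exact Finset.erase_subset_erase _ (Finset.erase_subset v τ)

/-- For `n = 0`, the case of the unit ideal, even the empty face is lost. -/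
lemma mem_faces_zero : τ ∈ faces G n 0 ↔ τ = ∅ ∧ n ≠ 0 := by
  classical
  rw [mem_faces, Finset.card_eq_zero]
  constructor
  · rintro ⟨-, rfl, h⟩
    refine ⟨rfl, ?_⟩
    rintro rfl
    exact h (zero_le)
  · rintro ⟨rfl, h⟩
    refine ⟨by simp, rfl, ?_⟩
    rwa [Finset.erase_empty, lcmOf, Finset.sup_empty, bot_eq_zero, nonpos_iff_eq_zero]

open Classical in
/-- A monomial of `G ∪ {1}` dividing `u`, equal to `n` whenever possible. -/
noncomputable def apex (G : Finset (ι →₀ ℕ)) (n u : ι →₀ ℕ) : ι →₀ ℕ :=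
  if n ≤ u then n else if h : ∃ g ∈ G, g ≤ u then h.choose else 0

lemma apex_le (G : Finset (ι →₀ ℕ)) (n u : ι →₀ ℕ) : apex G n u ≤ u := by
  rw [apex]
  split_ifs with h1 h2
  · exact h1
  · exact h2.choose_spec.2
  · exact zero_le

lemma apex_mem (hn : n ∈ G) {u : ι →₀ ℕ} (h : ∃ g ∈ G, g ≤ u) : apex G n u ∈ G := by
  rw [apex]
  split_ifs with h1
  · exact hn
  · exact h.choose_spec.1

open Classical in
lemma insert_apex_mem_faces (hn : n ∈ G) (hτ : τ ∈ faces G n i) {u : ι →₀ ℕ} (hu : lcmOf τ ≤ u)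
    (h : ∃ g ∈ G, g ≤ u) (hv : apex G n u ∉ τ) : insert (apex G n u) τ ∈ faces G n (i + 1) := by
  rw [mem_faces] at hτ ⊢
  refine ⟨Finset.insert_subset (apex_mem hn h) hτ.1, by
    rw [Finset.card_insert_of_notMem hv, hτ.2.1], fun hle => ?_⟩
  -- With apex `n` the face condition is untouched; otherwise the new lcm still divides `u`, which
  -- `n` does not divide.
  by_cases hnu : n ≤ u
  · have ha : apex G n u = n := if_pos hnu
    rw [ha] at hv hle
    rw [Finset.erase_insert hv] at hle
    rw [Finset.erase_eq_of_notMem hv] at hτ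
    exact hτ.2.2 hle
  · exact hnu (hle.trans ((lcmOf_mono (Finset.erase_subset n _)).trans
      (lcmOf_insert_le hu (apex_le G n u))))

open Classical in
lemma lcmOf_erase_ne (hdom : ∀ m ∈ G, m ≠ n → IsDominantMonomial G m) (hτ : τ ∈ faces G n i)
    {v : ι →₀ ℕ} (hv : v ∈ τ) : lcmOf (τ.erase v) ≠ lcmOf τ := by
  rw [mem_faces] at hτ
  intro h
  by_cases hvn : v = n
  · subst hvn
    exact hτ.2.2 (h ▸ le_lcmOf hv)
  · obtain ⟨x, e, he, hex, hlt⟩ := hdom v (hτ.1 hv) hvn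
    obtain ⟨m, hm, hem⟩ := exists_le_of_le_lcmOf he (h ▸ hex.trans (le_lcmOf hv x))
    rw [Finset.mem_erase] at hm
    exact hlt m (hτ.1 hm.2) hm.1 hem

open Classical in
lemma mem_faces_iff_isDominantSet (hdom : ∀ m ∈ G, m ≠ n → IsDominantMonomial G m)
    (hτ : τ ⊆ G) (hn : n ∈ τ) : τ ∈ faces G n τ.card ↔ IsDominantSet τ := by
  rw [mem_faces]
  constructor
  · rintro ⟨-, -, h⟩ m hm
    by_cases hmn : m = n
    · subst hmn
      obtain ⟨x, hx⟩ : ∃ x, lcmOf (τ.erase m) x < m x := by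
        by_contra! hle
        exact h hle
      -- The full exponent of `n` at a variable where it exceeds the lcm of the other elements.
      refine ⟨x, m x, by omega, le_rfl, fun m' hm' hne hle => ?_⟩
      have := le_lcmOf (Finset.mem_erase.2 ⟨hne, hm'⟩) x
      omega
    · obtain ⟨x, e, he, hex, hlt⟩ := hdom m (hτ hm) hmn
      exact ⟨x, e, he, hex, fun m' hm' => hlt m' (hτ hm')⟩
  · intro h
    refine ⟨hτ, rfl, fun hle => ?_⟩
    obtain ⟨x, e, he, hex, hlt⟩ := h n hn
    obtain ⟨m, hm, hem⟩ := exists_le_of_le_lcmOf he (hex.trans (hle x))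
    rw [Finset.mem_erase] at hm
    exact hlt m hm.2 hm.1 hem

lemma degree_lt_degree {u v : ι →₀ ℕ} (h : u < v) : u.degree < v.degree := by
  obtain ⟨w, rfl⟩ := exists_add_of_le h.le
  have : w.degree ≠ 0 := by
    rw [Ne, Finsupp.degree_eq_zero_iff]
    rintro rfl
    simp at h
  rw [map_add]
  omega

end Faces

/-! ### The minimal resolution and its regularity. -/

section Resolution

variable {ι : Type*} (k : Type*) [Field k]

/-- The faces in homological degree `i`, as a submodule of the Taylor module. -/
noncomputable abbrev faceModule (G : Finset (ι →₀ ℕ)) (n : ι →₀ ℕ) (i : ℕ) :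
    Submodule (MvPolynomial ι k) (TaylorModule ι k) :=
  Finsupp.supported (MvPolynomial ι k) (MvPolynomial ι k)
    (faces G n i : Set (Finset (ι →₀ ℕ)))

variable {k} {G : Finset (ι →₀ ℕ)} {n : ι →₀ ℕ}

lemma taylorD_single_mem_faceModule {i : ℕ} {τ : Finset (ι →₀ ℕ)} (hτ : τ ∈ faces G n (i + 1)) :
    taylorD k (Finsupp.single τ 1) ∈ faceModule k G n i := by
  classical
  rw [Finsupp.mem_supported']
  intro ρ hρ
  rcases taylorD_single_apply k τ ρ with h | ⟨v, hv, rfl, -⟩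
  · exact h
  · exact absurd (erase_mem_faces hτ hv) hρ

lemma taylorD_mem_faceModule {i : ℕ} {x : TaylorModule ι k}
    (hx : x ∈ faceModule k G n (i + 1)) : taylorD k x ∈ faceModule k G n i := by
  rw [faceModule, Finsupp.supported_eq_span_single] at hx
  induction hx using Submodule.span_induction with
  | mem x hx =>
    obtain ⟨τ, hτ, rfl⟩ := hx
    exact taylorD_single_mem_faceModule hτ
  | zero => rw [map_zero]; exact Submodule.zero_mem _
  | add x y _ _ hx hy => rw [map_add]; exact Submodule.add_mem _ hx hy
  | smul a x _ hx => rw [map_smul]; exact Submodule.smul_mem _ _ hx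

lemma taylorD_eq_zero_of_mem {x : TaylorModule ι k} (hx : x ∈ faceModule k G n 0) :
    taylorD k x = 0 := by
  rw [faceModule, Finsupp.supported_eq_span_single] at hx
  induction hx using Submodule.span_induction with
  | mem x hx =>
    obtain ⟨τ, hτ, rfl⟩ := hx
    obtain ⟨rfl, -⟩ := mem_faces_zero.1 (Finset.mem_coe.1 hτ)
    simp [taylorD]
  | zero => rw [map_zero]
  | add x y _ _ hx hy => rw [map_add, hx, hy, add_zero]
  | smul a x _ hx => rw [map_smul, hx, smul_zero]

lemma taylorD_apply_empty_mem {x : TaylorModule ι k} (hx : x ∈ faceModule k G n 1) :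
    taylorD k x ∅ ∈ monomialIdeal k G := by
  classical
  rw [faceModule, Finsupp.supported_eq_span_single] at hx
  induction hx using Submodule.span_induction with
  | mem x hx =>
    obtain ⟨τ, hτ, rfl⟩ := hx
    rcases taylorD_single_apply k τ ∅ with h | ⟨v, hv, he, h⟩
    · rw [h]; exact Submodule.zero_mem _
    · rw [h, monomialIdeal, MvPolynomial.mem_ideal_span_monomial_image]
      intro u hu
      have hu := Finset.mem_singleton.1 (MvPolynomial.support_monomial_subset hu)
      refine ⟨v, (mem_faces.1 (Finset.mem_coe.1 hτ)).1 hv, ?_⟩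
      rw [hu, lcmOf, lcmOf, Finset.sup_empty, bot_eq_zero, tsub_zero]
      exact le_lcmOf hv
  | zero => rw [map_zero]; exact Submodule.zero_mem _
  | add x y _ _ hx hy => rw [map_add]; exact Submodule.add_mem _ hx hy
  | smul a x _ hx => rw [map_smul]; exact Submodule.smul_mem _ _ hx

/-- The hypothesis on the multidegrees of `x` excludes the default apex `0`, which need not lie in
`G`. It holds in positive homological degree because of any vertex, and in degree zero for elements
of the ideal. -/
lemma contraction_mem_faceModule (hn : n ∈ G) {i : ℕ} {x : TaylorModule ι k}
    (hx : x ∈ faceModule k G n i)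
    (h : ∀ τ, ∀ w ∈ (x τ).support, ∃ g ∈ G, g ≤ w + lcmOf τ) :
    contraction k (apex G n) x ∈ faceModule k G n (i + 1) := by
  classical
  refine contraction_mem_supported k _ _ x fun τ w hw => ?_
  rw [coneElem]
  split_ifs with hv
  · exact Submodule.zero_mem _
  · refine Submodule.smul_of_tower_mem _ _ (Finsupp.single_mem_supported _ _ ?_)
    refine insert_apex_mem_faces hn ?_ le_add_self (h τ w hw) hv
    by_contra hτ
    rw [(Finsupp.mem_supported' _ _).1 hx τ hτ] at hw
    simp at hw

lemma taylorD_contraction_of_taylorD_eq_zero {x : TaylorModule ι k} (hx : taylorD k x = 0) :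
    taylorD k (contraction k (apex G n) x) = x := by
  simpa [hx] using taylorD_contraction_add k (apex G n) (apex_le G n) x

lemma exists_taylorD_eq (hn : n ∈ G) {i : ℕ} {x : TaylorModule ι k}
    (hx : x ∈ faceModule k G n (i + 1)) (h : taylorD k x = 0) :
    ∃ y ∈ faceModule k G n (i + 2), taylorD k y = x := by
  refine ⟨_, contraction_mem_faceModule hn hx fun τ w hw => ?_,
    taylorD_contraction_of_taylorD_eq_zero h⟩
  have hτ : τ ∈ faces G n (i + 1) := by
    by_contra hτ
    rw [(Finsupp.mem_supported' _ _).1 hx τ hτ] at hw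
    simp at hw
  obtain ⟨hG, hc, -⟩ := mem_faces.1 hτ
  obtain ⟨v, hv⟩ : τ.Nonempty := by
    rw [← Finset.card_pos]
    omega
  exact ⟨v, hG hv, (le_lcmOf hv).trans le_add_self⟩

lemma exists_taylorD_eq_of_mem_monomialIdeal (hn : n ∈ G) {x : TaylorModule ι k}
    (hx : x ∈ faceModule k G n 0) (h : x ∅ ∈ monomialIdeal k G) :
    ∃ y ∈ faceModule k G n 1, taylorD k y = x := by
  refine ⟨_, contraction_mem_faceModule hn hx fun τ w hw => ?_,
    taylorD_contraction_of_taylorD_eq_zero (taylorD_eq_zero_of_mem hx)⟩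
  have hτ : τ ∈ faces G n 0 := by
    by_contra hτ
    rw [(Finsupp.mem_supported' _ _).1 hx τ hτ] at hw
    simp at hw
  obtain ⟨rfl, -⟩ := mem_faces_zero.1 hτ
  rw [monomialIdeal, MvPolynomial.mem_ideal_span_monomial_image] at h
  obtain ⟨g, hg, hgw⟩ := h w hw
  exact ⟨g, hg, hgw.trans le_self_add⟩

variable (k) in
/-- The differential of the resolution supported on `faces G n`. -/
noncomputable def faceD (G : Finset (ι →₀ ℕ)) (n : ι →₀ ℕ) (i : ℕ) :
    (Fin (faces G n (i + 1)).card → MvPolynomial ι k) →ₗ[MvPolynomial ι k]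
      (Fin (faces G n i).card → MvPolynomial ι k) :=
  (toCoords (faces G n i)).comp ((taylorD k).comp (ofCoords (faces G n (i + 1))))

variable (k) in
/-- The augmentation of the resolution supported on `faces G n`. -/
noncomputable def faceAug (G : Finset (ι →₀ ℕ)) (n : ι →₀ ℕ) :
    (Fin (faces G n 0).card → MvPolynomial ι k) →ₗ[MvPolynomial ι k]
      (MvPolynomial ι k ⧸ monomialIdeal k G) :=
  (Submodule.mkQ (monomialIdeal k G)).comp
    ((Finsupp.lapply ∅).comp (ofCoords (faces G n 0)))

lemma ofCoords_faceD (i : ℕ) (x : Fin (faces G n (i + 1)).card → MvPolynomial ι k) :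
    ofCoords (faces G n i) (faceD k G n i x) = taylorD k (ofCoords (faces G n (i + 1)) x) :=
  ofCoords_toCoords _ (taylorD_mem_faceModule (ofCoords_mem_supported _ x))

lemma faceD_toCoords {i : ℕ} {y : TaylorModule ι k} (hy : y ∈ faceModule k G n (i + 1)) :
    faceD k G n i (toCoords _ y) = toCoords _ (taylorD k y) := by
  rw [faceD, LinearMap.comp_apply, LinearMap.comp_apply, ofCoords_toCoords _ hy]

lemma faceAug_eq_zero_iff (x : Fin (faces G n 0).card → MvPolynomial ι k) :
    faceAug k G n x = 0 ↔ ofCoords (faces G n 0) x ∅ ∈ monomialIdeal k G :=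
  Submodule.Quotient.mk_eq_zero _

lemma faceD_single_apply (i : ℕ) (b a) :
    faceD k G n i (Pi.single b 1) a =
      taylorD k (Finsupp.single ((faces G n (i + 1)).equivFin.symm b : Finset (ι →₀ ℕ)) 1)
        ((faces G n i).equivFin.symm a) := by
  rw [faceD, LinearMap.comp_apply, LinearMap.comp_apply, ofCoords_single, toCoords_apply]

/-- The minimal graded free resolution supported on `faces G n`. -/
noncomputable def faceResolution (hn : n ∈ G)
    (hdom : ∀ m ∈ G, m ≠ n → IsDominantMonomial G m) :
    MinimalGradedFreeResolution (monomialIdeal k G) where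
  rank i := (faces G n i).card
  deg i a := (Finsupp.degree (lcmOf ((faces G n i).equivFin.symm a : Finset (ι →₀ ℕ))) : ℕ)
  d := faceD k G n
  aug := faceAug k G n
  d_graded i b a := by
    classical
    rw [faceD_single_apply]
    rcases taylorD_single_apply k ((faces G n (i + 1)).equivFin.symm b : Finset (ι →₀ ℕ))
      ((faces G n i).equivFin.symm a) with h | ⟨v, -, he, h⟩
    · rw [h]
      simp [IsHomogeneousOfDegree]
    · rw [h]
      intro u hu
      have hu := Finset.mem_singleton.1 (MvPolynomial.support_monomial_subset hu)
      have hle : lcmOf ((faces G n i).equivFin.symm a : Finset (ι →₀ ℕ)) ≤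
          lcmOf ((faces G n (i + 1)).equivFin.symm b : Finset (ι →₀ ℕ)) := by
        rw [he]
        exact lcmOf_mono (Finset.erase_subset _ _)
      have := congrArg Finsupp.degree (tsub_add_cancel_of_le hle)
      rw [map_add, ← hu] at this
      omega
  aug_graded a := by
    obtain ⟨he, -⟩ := mem_faces_zero.1 ((faces G n 0).equivFin.symm a).2
    refine ⟨1, ?_, ?_⟩
    · intro u hu
      rw [← MvPolynomial.C_1] at hu
      have hu := Finset.mem_singleton.1 (MvPolynomial.support_monomial_subset hu)
      rw [hu, he, lcmOf, Finset.sup_empty, bot_eq_zero]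
    · rw [faceAug, LinearMap.comp_apply, LinearMap.comp_apply, ofCoords_single, he,
        Finsupp.lapply_apply, Finsupp.single_eq_same]
      rfl
  aug_surjective y := by
    obtain ⟨p, rfl⟩ := Submodule.mkQ_surjective _ y
    -- If `n = 0`, there are no faces and the quotient is zero.
    by_cases h : n = 0
    · refine ⟨0, ?_⟩
      rw [map_zero, eq_comm, Submodule.mkQ_apply, Submodule.Quotient.mk_eq_zero, monomialIdeal,
        MvPolynomial.mem_ideal_span_monomial_image]
      exact fun u _ => ⟨n, hn, h ▸ zero_le⟩
    · refine ⟨toCoords _ (Finsupp.single ∅ p), ?_⟩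
      rw [faceAug, LinearMap.comp_apply, LinearMap.comp_apply, ofCoords_toCoords,
        Finsupp.lapply_apply, Finsupp.single_eq_same]
      exact Finsupp.single_mem_supported _ _ (mem_faces_zero.2 ⟨rfl, h⟩)
  exact_zero x := by
    rw [faceAug_eq_zero_iff]
    constructor
    · intro h
      obtain ⟨y, hy, hyx⟩ :=
        exists_taylorD_eq_of_mem_monomialIdeal hn (ofCoords_mem_supported _ x) h
      exact ⟨toCoords _ y, by rw [faceD_toCoords hy, hyx, toCoords_ofCoords]⟩
    · rintro ⟨y, rfl⟩
      rw [ofCoords_faceD]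
      exact taylorD_apply_empty_mem (ofCoords_mem_supported _ y)
  exact_succ i x := by
    constructor
    · intro h
      obtain ⟨y, hy, hyx⟩ := exists_taylorD_eq hn (ofCoords_mem_supported _ x)
        (by rw [← ofCoords_faceD, h, map_zero])
      exact ⟨toCoords _ y, by rw [faceD_toCoords hy, hyx, toCoords_ofCoords]⟩
    · rintro ⟨y, rfl⟩
      rw [← toCoords_ofCoords _ (faceD k G n i _), ofCoords_faceD, ofCoords_faceD,
        taylorD_taylorD, map_zero]
  minimal i b a := by
    classical
    rw [faceD_single_apply]
    rcases taylorD_single_apply k ((faces G n (i + 1)).equivFin.symm b : Finset (ι →₀ ℕ))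
      ((faces G n i).equivFin.symm a) with h | ⟨v, hv, he, h⟩
    · rw [h, map_zero]
    · rw [h, MvPolynomial.constantCoeff_monomial, if_neg]
      intro h0
      have hle := tsub_eq_zero_iff_le.1 h0
      rw [he] at hle
      exact lcmOf_erase_ne hdom ((faces G n (i + 1)).equivFin.symm b).2 hv
        (le_antisymm (lcmOf_mono (Finset.erase_subset _ _)) hle)

lemma faceResolution_betti_ne_zero_iff (hn : n ∈ G)
    (hdom : ∀ m ∈ G, m ≠ n → IsDominantMonomial G m) (i : ℕ) (j : ℤ) :
    (faceResolution (k := k) hn hdom).betti i j ≠ 0 ↔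
      ∃ τ ∈ faces G n i, ((Finsupp.degree (lcmOf τ) : ℕ) : ℤ) = j := by
  rw [MinimalGradedFreeResolution.betti_ne_zero_iff_exists]
  constructor
  · rintro ⟨a, ha⟩
    exact ⟨_, ((faces G n i).equivFin.symm a).2, ha⟩
  · rintro ⟨τ, hτ, h⟩
    refine ⟨(faces G n i).equivFin ⟨τ, hτ⟩, ?_⟩
    simpa [faceResolution] using h

lemma faceResolution_regularity (hn : n ∈ G)
    (hdom : ∀ m ∈ G, m ≠ n → IsDominantMonomial G m) :
    (faceResolution (k := k) hn hdom).regularity =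
      sSup {r : WithBot (WithTop ℤ) | ∃ s : Finset (ι →₀ ℕ),
        s ⊆ G ∧ n ∈ s ∧ IsDominantSet s ∧
        r = (((Finsupp.degree (lcmOf s) : ℕ) : ℤ) - (s.card : ℤ) : ℤ)} := by
  classical
  rw [MinimalGradedFreeResolution.regularity]
  refine le_antisymm (sSup_le ?_) (sSup_le ?_)
  · rintro r ⟨i, j, hb, rfl⟩
    obtain ⟨τ, hτ, rfl⟩ := (faceResolution_betti_ne_zero_iff hn hdom i j).1 hb
    obtain ⟨hG, rfl, hnd⟩ := mem_faces.1 hτ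
    by_cases hnτ : n ∈ τ
    · exact le_sSup ⟨τ, hG, hnτ, (mem_faces_iff_isDominantSet hdom hG hnτ).1 hτ, rfl⟩
    -- A face without `n` is dominated by the face obtained by adding `n`.
    · have hiG : insert n τ ⊆ G := Finset.insert_subset hn hG
      rw [Finset.erase_eq_of_notMem hnτ] at hnd
      have hmem : insert n τ ∈ faces G n (insert n τ).card := by
        rw [mem_faces, Finset.erase_insert hnτ]
        exact ⟨hiG, rfl, hnd⟩
      have hlt : lcmOf τ < lcmOf (insert n τ) :=
        lt_of_le_not_ge (lcmOf_mono (Finset.subset_insert _ _)) fun hle =>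
          hnd ((le_lcmOf (Finset.mem_insert_self _ _)).trans hle)
      have hdeg := degree_lt_degree hlt
      refine le_trans ?_ (le_sSup ⟨insert n τ, hiG, Finset.mem_insert_self _ _,
        (mem_faces_iff_isDominantSet hdom hiG (Finset.mem_insert_self _ _)).1 hmem, rfl⟩)
      rw [Finset.card_insert_of_notMem hnτ]
      refine WithBot.coe_le_coe.2 (WithTop.coe_le_coe.2 ?_)
      push_cast
      omega
  · rintro r ⟨s, hs, hns, hd, rfl⟩
    exact le_sSup ⟨s.card, _, (faceResolution_betti_ne_zero_iff hn hdom _ _).2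
      ⟨s, (mem_faces_iff_isDominantSet hdom hs hns).2 hd, rfl⟩, rfl⟩

end Resolution

end SemidominantIdeals

theorem corollary5p14 {ι : Type*} [Finite ι] {k : Type*} [Field k]
    (M : Ideal (MvPolynomial ι k)) (G : Finset (ι →₀ ℕ))
    (hG : SemidominantIdeals.IsMinimalGeneratingSet M G)
    (hM : SemidominantIdeals.IsSemidominantSet G)
    (n : ι →₀ ℕ) (hn : n ∈ G) (hnd : ¬ SemidominantIdeals.IsDominantMonomial G n) :
    Nonempty (SemidominantIdeals.MinimalGradedFreeResolution M) ∧
    ∀ F : SemidominantIdeals.MinimalGradedFreeResolution M,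
      F.regularity =
        sSup {r : WithBot (WithTop ℤ) | ∃ s : Finset (ι →₀ ℕ),
          s ⊆ G ∧ n ∈ s ∧ SemidominantIdeals.IsDominantSet s ∧
          r = (((Finsupp.degree (SemidominantIdeals.lcmOf s) : ℕ) : ℤ) - (s.card : ℤ) : ℤ)} := by
  obtain ⟨rfl, -⟩ := hG
  have hdom : ∀ m ∈ G, m ≠ n → SemidominantIdeals.IsDominantMonomial G m := fun m hm hmn => by
    by_contra h
    exact hmn (hM.unique ⟨hm, h⟩ ⟨hn, hnd⟩)
  refine ⟨⟨SemidominantIdeals.faceResolution hn hdom⟩, fun F => ?_⟩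
  rw [← SemidominantIdeals.faceResolution_regularity (k := k) hn hdom]
  exact SemidominantIdeals.MinimalGradedFreeResolution.regularity_eq
    (fun _ hp e => SemidominantIdeals.degreeComponent_mem_monomialIdeal hp e) _ _
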